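/- Let $\kappa,k\ge 0$ be integers and $n=\kappa+k$. Let $G\in\mathbb F_2^{\kappa\times n}$ and $G'\in\mathbb F_2^{k\times n}$ be such that the $n$ rows of $\begin{bmatrix}G'\\ G\end{bmatrix}$ are linearly independent. A uniformly distributed message $M\in\mathbb F_2^k$ is encoded, with an independent uniformly distributed auxiliary message $M'\in\mathbb F_2^\kappa$, as $X=[M\ \ M']\begin{bmatrix}G'\\ G\end{bmatrix}$, and $Z\in\{0,1,?\}^n$ is the word observed by an eavesdropper who sees some of the bits of $X$, the others being erased (replaced by $?$), where the set of revealed positions is random and independent of $(M,M')$. For $0\le i\le 2^\kappa-1$ let $\nu(i)\in\mathbb F_2^\kappa$ be the vector of binary digits of $i$ (least significant digit first) and let $q_i$ be the fraction of the $n$ columns of $G$ that are equal to $\nu(i)$. Let $W=\mathbb F_2^\kappa$, let $\Xi(W,d)$ be the set of $d$-dimensional subspaces of $W$, and for a subspace $S\subseteq W$ put $$\zeta(S)=\sum_{i:\nu(i)\in S}q_i,\qquad \Phi(S)=\prod_{i=0}^{\mu-1}\frac{\zeta(S)-\frac in}{1-\frac in},\qquad \phi(S)=\epsilon^{\,n(1-\zeta(S))}\quad(0^0=1),\qquad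 K_\delta=\prod_{i=1}^{\delta-1}(1-2^i).$$ Let $I(M;Z)$ be the mutual information in bits (the equivocation loss of the code). (1) If exactly $\mu$ bits are revealed, $0<\mu\le n$, all $\mu$-element sets of positions being equally likely, then $$I(M;Z)=\mu-\kappa+\sum_{\delta=1}^{\kappa}K_\delta\sum_{S\in\Xi(W,\kappa-\delta)}\Phi(S).$$ (2) If every bit is erased independently with probability $\epsilon\in[0,1]$, then $$I(M;Z)=n(1-\epsilon)-\kappa+\sum_{\delta=1}^{\kappa}K_\delta\sum_{S\in\Xi(W,\kappa-\delta)}\phi(S).$$ -/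

import Mathlib

open scoped BigOperators

namespace CosetCode

noncomputable section

/-! ### The coset encoder and the eavesdropper's channel -/

/-- Binary row vectors of length `n`. -/
abbrev BitVec2 (n : ℕ) : Type := Fin n → ZMod 2

/-- Words received by the eavesdropper: `none` is the erasure symbol `?`. -/
abbrev Received (n : ℕ) : Type := Fin n → Option (ZMod 2)

/-- The codeword `x = [m m'] [G'; G]` of the message `m` and the auxiliary message `m'`. -/
def encode {k κ n : ℕ} (G' : Matrix (Fin k) (Fin n) (ZMod 2)) (G : Matrix (Fin κ) (Fin n) (ZMod 2))
    (m : BitVec2 k) (m' : BitVec2 κ) : BitVec2 n :=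
  Matrix.vecMul (Sum.elim m m') (Matrix.fromRows G' G)

/-- The set `r(z)` of revealed (non-erased) positions of `z`. -/
def revealed {n : ℕ} (z : Received n) : Finset (Fin n) :=
  Finset.univ.filter (fun i => z i ≠ none)

/-- Transition probabilities `Pr(Z = z | X = x)` of the memoryless binary erasure channel with
erasure probability `ε`. -/
def erasureChannel {n : ℕ} (ε : ℝ) (x : BitVec2 n) (z : Received n) : ℝ :=
  ∏ i, if z i = none then ε else if z i = some (x i) then 1 - ε else 0

/-- Transition probabilities `Pr(Z = z | X = x)` of the erasure channel given that exactly `μ`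
positions are revealed: the set of revealed positions is uniform among the `μ`-element sets. -/
def fixedRevealChannel {n : ℕ} (μ : ℕ) (x : BitVec2 n) (z : Received n) : ℝ :=
  if (revealed z).card = μ ∧ ∀ i ∈ revealed z, z i = some (x i) then 1 / (n.choose μ : ℝ) else 0

/-- The joint distribution `p_{MZ}` of message and received word, when the message and the
auxiliary message are independent and uniform and the codeword is sent over `channel`. -/
def jointDist {k κ n : ℕ} (channel : BitVec2 n → Received n → ℝ)
    (G' : Matrix (Fin k) (Fin n) (ZMod 2)) (G : Matrix (Fin κ) (Fin n) (ZMod 2))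
    (m : BitVec2 k) (z : Received n) : ℝ :=
  ∑ m' : BitVec2 κ, (1 / 2 ^ k : ℝ) * (1 / 2 ^ κ : ℝ) * channel (encode G' G m m') z

/-- Mutual information, in bits, of a joint probability mass function on a finite product: the
Kullback-Leibler divergence of the joint distribution from the product of its marginals. -/
def mutualInformation {A B : Type*} [Fintype A] [Fintype B] (p : A → B → ℝ) : ℝ :=
  ∑ a, ∑ b, p a b * Real.logb 2 (p a b / ((∑ b', p a b') * (∑ a', p a' b)))

/-- The equivocation loss `I(M;Z)` of the coset code with generator matrix `G` and auxiliary
generator matrix `G'`. -/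
def equivocationLoss {k κ n : ℕ} (channel : BitVec2 n → Received n → ℝ)
    (G' : Matrix (Fin k) (Fin n) (ZMod 2)) (G : Matrix (Fin κ) (Fin n) (ZMod 2)) : ℝ :=
  mutualInformation (jointDist channel G' G)

/-! ### Column fractions and subspaces -/

/-- The binary vector expansion `ν(i)` of `i`, least significant bit first. -/
def binaryExpansion {κ : ℕ} (i : Fin (2 ^ κ)) : BitVec2 κ :=
  fun j => if Nat.testBit (i : ℕ) (j : ℕ) then 1 else 0

/-- The fraction of the columns of `G` that are equal to `ν(i)`. -/
def columnFraction {κ n : ℕ} (G : Matrix (Fin κ) (Fin n) (ZMod 2)) (i : Fin (2 ^ κ)) : ℝ :=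
  ((Finset.univ.filter (fun j : Fin n => G.col j = binaryExpansion i)).card : ℝ) / (n : ℝ)

/-- The set `Ξ(S,d)` of the `d`-dimensional subspaces of `S`. -/
def subspacesOfDim {κ : ℕ} (S : Submodule (ZMod 2) (BitVec2 κ)) (d : ℕ) :
    Finset (Submodule (ZMod 2) (BitVec2 κ)) :=
  (Set.toFinite {T : Submodule (ZMod 2) (BitVec2 κ) | T ≤ S ∧ Module.finrank (ZMod 2) T = d}).toFinset

open Classical in
/-- `ζ(S,q)`, the sum of the `q i` with `ν(i) ∈ S`. -/
def zeta {κ : ℕ} (q : Fin (2 ^ κ) → ℝ) (S : Submodule (ZMod 2) (BitVec2 κ)) : ℝ :=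
  ∑ i ∈ Finset.univ.filter (fun i : Fin (2 ^ κ) => binaryExpansion i ∈ S), q i

/-- `Φ(S,n,μ,q)`. -/
def PhiFixed {κ : ℕ} (n μ : ℕ) (q : Fin (2 ^ κ) → ℝ) (S : Submodule (ZMod 2) (BitVec2 κ)) : ℝ :=
  ∏ i ∈ Finset.range μ, (zeta q S - (i : ℝ) / (n : ℝ)) / (1 - (i : ℝ) / (n : ℝ))

/-- `φ(S,n,ε,q)`. -/
def phiErasure {κ : ℕ} (n : ℕ) (ε : ℝ) (q : Fin (2 ^ κ) → ℝ)
    (S : Submodule (ZMod 2) (BitVec2 κ)) : ℝ :=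
  ε ^ ((n : ℝ) * (1 - zeta q S))

/-- The constants `K_δ = ∏_{i=1}^{δ-1} (1 - 2^i)`, for `δ ≥ 1`. -/
def K (δ : ℕ) : ℝ := ∏ i ∈ Finset.Icc 1 (δ - 1), (1 - (2 : ℝ) ^ i)

end

end CosetCode

/-! Let `R` be the set of revealed positions. Each channel draws `R` independently of the codeword
and shows the codeword on `R`, so `I(M;Z)` is an average over `R` of the information carried by the
positions in `R`. For fixed `R`, the auxiliary messages compatible with given `M` and `Z` form a
coset of `hiddenSpace G R`, the orthogonal complement of the columns of `G` in `R`, while the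
codeword itself is uniform because the stacked generator matrix is invertible. Hence that
information is `#R - κ + dim (hiddenSpace G R)` bits (`equivocationLoss_eq_sum`).

The dimension `c` of a binary space is the combination `∑ K_δ [c, δ]` of the numbers `[c, δ]` of its
`δ`-dimensional subspaces, by the `q`-Pascal rule (`sum_K_mul_gaussianBinomial`). Duality turns the
`δ`-dimensional subspaces of `hiddenSpace G R` into the subspaces `S` of codimension `δ` containing
all the columns in `R` (`card_subspaces_containing_columns`). Averaging over `R` therefore leaves
the expected number of revealed positions and, for each `S`, the probability that every revealed
column lies in `S` (`equivocationLoss_eq`). With `n ζ(S)` columns in `S`, this probability is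
`choose (n ζ(S)) μ / choose n μ = Φ(S)` for `μ` revealed positions, and `ε ^ (n - n ζ(S)) = φ(S)`
for independent erasures. -/

open Module

namespace CosetCode

/-! ### Counting the subspaces of a vector space over a finite field -/

/-- Double counting of linearly independent `d`-tuples in `U`: each of them spans exactly one
`d`-dimensional subspace, and each such subspace is spanned by all its own independent tuples. -/
theorem card_subspaces_mul_card_bases {F E : Type*} [Field F] [Fintype F] [AddCommGroup E]
    [Module F E] [Finite E] (U : Submodule F E) {d : ℕ} (hd : d ≤ finrank F U) :
    Nat.card {T : Submodule F E // T ≤ U ∧ finrank F T = d} *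
        ∏ i : Fin d, (Fintype.card F ^ d - Fintype.card F ^ (i : ℕ)) =
      ∏ i : Fin d, (Fintype.card F ^ finrank F U - Fintype.card F ^ (i : ℕ)) := by
  classical
  have := Fintype.ofFinite E
  have := Fintype.ofFinite U
  let f : {s : Fin d → U // LinearIndependent F s} →
      {T : Submodule F E // T ≤ U ∧ finrank F T = d} := fun s =>
    ⟨Submodule.span F (Set.range fun i => (s.1 i : E)), by
      rw [Submodule.span_le]; rintro _ ⟨i, rfl⟩; exact (s.1 i).2, by
      have h : LinearIndependent F fun i => (s.1 i : E) :=
        s.2.map' U.subtype (Submodule.ker_subtype U)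
      rw [finrank_span_eq_card h, Fintype.card_fin]⟩
  rw [← card_linearIndependent (K := F) (V := U) hd,
    Nat.card_congr (Equiv.sigmaFiberEquiv f).symm, Nat.card_sigma]
  have key : ∀ T : {T : Submodule F E // T ≤ U ∧ finrank F T = d},
      Nat.card {s // f s = T} =
        ∏ i : Fin d, (Fintype.card F ^ d - Fintype.card F ^ (i : ℕ)) := by
    rintro ⟨T, hTU, hT⟩
    have := Fintype.ofFinite T
    have h := card_linearIndependent (K := F) (V := T) (k := d) hT.ge
    rw [hT] at h
    rw [← h]
    refine Nat.card_congr
      { toFun := fun s => ⟨fun i => ⟨(s.1.1 i : E), ?_⟩, ?_⟩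
        invFun := fun s => ⟨⟨fun i => ⟨(s.1 i : E), hTU (s.1 i).2⟩, ?_⟩, ?_⟩
        left_inv := fun s => rfl
        right_inv := fun s => rfl }
    · have hspan : (f s.1).1 = T := congrArg Subtype.val s.2
      exact hspan.le (Submodule.subset_span ⟨i, rfl⟩)
    · refine LinearIndependent.of_comp T.subtype ?_
      exact s.1.2.map' U.subtype (Submodule.ker_subtype U)
    · refine LinearIndependent.of_comp U.subtype ?_
      exact s.2.map' T.subtype (Submodule.ker_subtype T)
    · apply Subtype.ext
      have h : LinearIndependent F fun i => (s.1 i : E) :=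
        s.2.map' T.subtype (Submodule.ker_subtype T)
      refine Submodule.eq_of_le_of_finrank_eq ?_ ?_
      · change Submodule.span F (Set.range fun i => (s.1 i : E)) ≤ T
        rw [Submodule.span_le]; rintro _ ⟨i, rfl⟩; exact (s.1 i).2
      · change finrank F (Submodule.span F (Set.range fun i => (s.1 i : E))) = _
        rw [finrank_span_eq_card h, Fintype.card_fin, hT]
  rw [Finset.sum_congr rfl fun T _ => key T]
  simp

/-- The Gaussian binomial coefficient `[c, d]` at `2`, written as the number of independent
`d`-tuples in a `c`-dimensional space over that in a `d`-dimensional one. It is `0` for `c < d`. -/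
noncomputable def gaussianBinomial (c d : ℕ) : ℝ :=
  (∏ i ∈ Finset.range d, ((2 : ℝ) ^ c - 2 ^ i)) / ∏ i ∈ Finset.range d, ((2 : ℝ) ^ d - 2 ^ i)

theorem two_pow_sub_two_pow_ne_zero {d i : ℕ} (h : i < d) : (2 : ℝ) ^ d - 2 ^ i ≠ 0 :=
  sub_ne_zero.2 (pow_lt_pow_right₀ one_lt_two h).ne'

@[simp] theorem gaussianBinomial_zero (c : ℕ) : gaussianBinomial c 0 = 1 := by
  simp [gaussianBinomial]

theorem gaussianBinomial_eq_zero {c d : ℕ} (h : c < d) : gaussianBinomial c d = 0 := by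
  rw [gaussianBinomial, Finset.prod_eq_zero (Finset.mem_range.2 h) (sub_self _), zero_div]

theorem prod_two_pow_succ (c d : ℕ) :
    ∏ i ∈ Finset.range (d + 1), ((2 : ℝ) ^ (c + 1) - 2 ^ i) =
      (2 ^ (c + 1) - 1) * (2 ^ d * ∏ i ∈ Finset.range d, ((2 : ℝ) ^ c - 2 ^ i)) := by
  rw [Finset.prod_range_succ', pow_zero, mul_comm]
  congr 1
  rw [← Finset.card_range d, ← Finset.prod_const, Finset.card_range, ← Finset.prod_mul_distrib]
  exact Finset.prod_congr rfl fun i _ => by ring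

/-- The `q`-Pascal rule at `q = 2`. -/
theorem gaussianBinomial_succ_succ (c d : ℕ) :
    gaussianBinomial (c + 1) (d + 1) =
      2 ^ (d + 1) * gaussianBinomial c (d + 1) + gaussianBinomial c d := by
  have h1 : (2 : ℝ) ^ (d + 1) - 1 ≠ 0 := by
    simpa using two_pow_sub_two_pow_ne_zero (Nat.succ_pos d)
  have h2 : ∏ i ∈ Finset.range d, ((2 : ℝ) ^ d - 2 ^ i) ≠ 0 :=
    Finset.prod_ne_zero_iff.2 fun i hi => two_pow_sub_two_pow_ne_zero (Finset.mem_range.1 hi)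
  unfold gaussianBinomial
  rw [prod_two_pow_succ c d, prod_two_pow_succ d d, Finset.prod_range_succ]
  generalize ∏ i ∈ Finset.range d, ((2 : ℝ) ^ d - 2 ^ i) = D at *
  generalize ∏ i ∈ Finset.range d, ((2 : ℝ) ^ c - 2 ^ i) = P at *
  field_simp
  ring

theorem K_one : K 1 = 1 := by simp [K]

theorem K_succ_succ (d : ℕ) : K (d + 2) = K (d + 1) * (1 - 2 ^ (d + 1)) := by
  simp only [K, Nat.add_sub_cancel, show d + 2 - 1 = d + 1 from rfl]
  rw [Finset.prod_Icc_succ_top (by omega)]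

/-- The constants `K` are the coefficients that express the dimension `c` through the Gaussian
binomials `[c, 1], [c, 2], …`. -/
theorem sum_K_mul_gaussianBinomial (N c : ℕ) (h : c ≤ N) :
    ∑ d ∈ Finset.range N, K (d + 1) * gaussianBinomial c (d + 1) = c := by
  induction c with
  | zero => simp [gaussianBinomial_eq_zero]
  | succ c ih =>
    obtain ⟨M, rfl⟩ : ∃ M, N = M + 1 := ⟨N - 1, by omega⟩
    -- The two terms of the Pascal rule recombine: `K (d + 1) * 2 ^ (d + 1) + K (d + 2) = K (d + 1)`.
    have hshift : ∑ d ∈ Finset.range (M + 1), K (d + 1) * gaussianBinomial c d =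
        ∑ d ∈ Finset.range (M + 1), K (d + 1) * (1 - 2 ^ (d + 1)) * gaussianBinomial c (d + 1)
          + 1 := by
      rw [Finset.sum_range_succ', Finset.sum_range_succ,
        gaussianBinomial_eq_zero (show c < M + 1 by omega)]
      simp [K_succ_succ, K_one]
    simp only [gaussianBinomial_succ_succ, mul_add, Finset.sum_add_distrib]
    rw [hshift, ← add_assoc, ← Finset.sum_add_distrib, Nat.cast_add_one, ← ih (by omega)]
    congr 1
    exact Finset.sum_congr rfl fun d _ => by ring

theorem card_subspaces_eq_gaussianBinomial {E : Type*} [AddCommGroup E] [Module (ZMod 2) E]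
    [Finite E] (U : Submodule (ZMod 2) E) (d : ℕ) :
    (Nat.card {T : Submodule (ZMod 2) E // T ≤ U ∧ finrank (ZMod 2) T = d} : ℝ) =
      gaussianBinomial (finrank (ZMod 2) U) d := by
  rcases lt_or_ge (finrank (ZMod 2) U) d with h | h
  · rw [gaussianBinomial_eq_zero h, Nat.cast_eq_zero, Nat.card_eq_zero]
    left
    refine ⟨fun T => ?_⟩
    have := Submodule.finrank_mono T.2.1
    have := T.2.2
    omega
  · have key := congrArg (Nat.cast (R := ℝ)) (card_subspaces_mul_card_bases U h)
    have hcast : ∀ m, d ≤ m → ((∏ i : Fin d, (2 ^ m - 2 ^ (i : ℕ)) : ℕ) : ℝ) =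
        ∏ i ∈ Finset.range d, ((2 : ℝ) ^ m - 2 ^ i) := by
      intro m hm
      rw [Finset.prod_range, Nat.cast_prod]
      refine Finset.prod_congr rfl fun i _ => ?_
      rw [Nat.cast_sub (Nat.pow_le_pow_right two_pos (i.2.le.trans hm))]
      push_cast
      rfl
    simp only [ZMod.card, Nat.cast_mul] at key
    rw [hcast d le_rfl, hcast _ h] at key
    rw [gaussianBinomial, eq_div_iff, key]
    exact Finset.prod_ne_zero_iff.2 fun i hi => two_pow_sub_two_pow_ne_zero (Finset.mem_range.1 hi)

/-! ### Auxiliary messages that a set of positions does not reveal -/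

/-- The auxiliary messages whose contribution to the codeword vanishes on the positions in `R`:
the orthogonal complement of the columns of `G` in `R`. Its dimension is `κ - rank G_R`. -/
def hiddenSpace {κ n : ℕ} (G : Matrix (Fin κ) (Fin n) (ZMod 2)) (R : Finset (Fin n)) :
    Submodule (ZMod 2) (BitVec2 κ) where
  carrier := {v | ∀ j ∈ R, v ⬝ᵥ G.col j = 0}
  add_mem' ha hb j hj := by rw [add_dotProduct, ha j hj, hb j hj, add_zero]
  zero_mem' j _ := zero_dotProduct _
  smul_mem' c v hv j hj := by rw [smul_dotProduct, hv j hj, smul_zero]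

/-- The dot product as a bilinear form on binary vectors. -/
def dotForm (κ : ℕ) : LinearMap.BilinForm (ZMod 2) (BitVec2 κ) :=
  dotProductBilin (ZMod 2) (ZMod 2)

theorem dotForm_apply {κ : ℕ} (v w : BitVec2 κ) : dotForm κ v w = v ⬝ᵥ w := rfl

theorem dotForm_isRefl (κ : ℕ) : (dotForm κ).IsRefl := fun v w h => by
  rw [dotForm_apply] at *
  rwa [dotProduct_comm]

theorem dotForm_nondegenerate (κ : ℕ) : (dotForm κ).Nondegenerate := by
  refine ⟨fun _ h => ?_, fun v h => ?_⟩
  · exact dotProduct_eq_zero _ h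
  · exact dotProduct_eq_zero v fun w => by rw [dotProduct_comm]; exact h w

theorem le_hiddenSpace_iff {κ n : ℕ} (G : Matrix (Fin κ) (Fin n) (ZMod 2)) (R : Finset (Fin n))
    (T : Submodule (ZMod 2) (BitVec2 κ)) :
    T ≤ hiddenSpace G R ↔ ∀ j ∈ R, G.col j ∈ (dotForm κ).orthogonal T :=
  ⟨fun h j hj _ hv => h hv j hj, fun h v hv j hj => h j hj v hv⟩

theorem mem_subspacesOfDim_top {κ d : ℕ} {S : Submodule (ZMod 2) (BitVec2 κ)} :
    S ∈ subspacesOfDim ⊤ d ↔ finrank (ZMod 2) S = d := by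
  simp [subspacesOfDim]

open Classical in
/-- Duality: the subspaces of codimension `δ` containing the columns in `R` are the orthogonal
complements of the `δ`-dimensional subspaces of `hiddenSpace G R`. -/
theorem card_subspaces_containing_columns {κ n : ℕ} (G : Matrix (Fin κ) (Fin n) (ZMod 2))
    (R : Finset (Fin n)) {δ : ℕ} (hδ : δ ≤ κ) :
    (((subspacesOfDim ⊤ (κ - δ)).filter fun S => ∀ j ∈ R, G.col j ∈ S).card : ℝ) =
      gaussianBinomial (finrank (ZMod 2) (hiddenSpace G R)) δ := by
  have hnd := dotForm_nondegenerate κ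
  have hrefl := dotForm_isRefl κ
  rw [← card_subspaces_eq_gaussianBinomial, Nat.cast_inj, Nat.card_eq_fintype_card,
    Fintype.card_subtype]
  refine Finset.card_nbij' (dotForm κ).orthogonal (dotForm κ).orthogonal ?_ ?_
    (fun S _ => LinearMap.BilinForm.orthogonal_orthogonal hnd hrefl S)
    (fun T _ => LinearMap.BilinForm.orthogonal_orthogonal hnd hrefl T)
  · intro S hS
    simp only [Finset.coe_filter, Set.mem_ofPred_eq, mem_subspacesOfDim_top] at hS
    simp only [Finset.coe_filter, Set.mem_ofPred_eq, Finset.mem_univ, true_and, le_hiddenSpace_iff,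
      LinearMap.BilinForm.orthogonal_orthogonal hnd hrefl]
    refine ⟨hS.2, ?_⟩
    rw [LinearMap.BilinForm.finrank_orthogonal hnd, hS.1, finrank_fin_fun]
    omega
  · intro T hT
    simp only [Finset.coe_filter, Set.mem_ofPred_eq, Finset.mem_univ, true_and,
      le_hiddenSpace_iff] at hT
    simp only [Finset.coe_filter, Set.mem_ofPred_eq, mem_subspacesOfDim_top]
    refine ⟨?_, hT.1⟩
    rw [LinearMap.BilinForm.finrank_orthogonal hnd, hT.2, finrank_fin_fun]

theorem finrank_hiddenSpace {κ n : ℕ} (G : Matrix (Fin κ) (Fin n) (ZMod 2))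
    (R : Finset (Fin n)) [∀ S : Submodule (ZMod 2) (BitVec2 κ), Decidable (∀ j ∈ R, G.col j ∈ S)] :
    (finrank (ZMod 2) (hiddenSpace G R) : ℝ) = ∑ δ ∈ Finset.Icc 1 κ, K δ *
      ∑ S ∈ subspacesOfDim (⊤ : Submodule (ZMod 2) (BitVec2 κ)) (κ - δ),
        if ∀ j ∈ R, G.col j ∈ S then 1 else 0 := by
  classical
  have hle : finrank (ZMod 2) (hiddenSpace G R) ≤ κ := by
    simpa using Submodule.finrank_le (hiddenSpace G R)
  rw [← sum_K_mul_gaussianBinomial κ _ hle, Finset.range_eq_Ico,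
    Finset.sum_Ico_add' (fun d => K d * gaussianBinomial (finrank (ZMod 2) (hiddenSpace G R)) d)]
  refine Finset.sum_congr (by ext; simp) fun δ hδ => ?_
  rw [← card_subspaces_containing_columns G R (Finset.mem_Icc.1 hδ).2, Finset.sum_boole]
  congr!

/-! ### Mutual information for a channel that reveals a random set of positions -/

/-- `z` agrees with the codeword `x` on the positions it reveals. -/
abbrev Agrees {n : ℕ} (x : BitVec2 n) (z : Received n) : Prop :=
  ∀ i ∈ revealed z, z i = some (x i)

theorem encode_apply {k κ n : ℕ} (G' : Matrix (Fin k) (Fin n) (ZMod 2))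
    (G : Matrix (Fin κ) (Fin n) (ZMod 2)) (m : BitVec2 k) (m' : BitVec2 κ) (i : Fin n) :
    encode G' G m m' i = m ⬝ᵥ G'.col i + m' ⬝ᵥ G.col i := by
  simp [encode, Matrix.vecMul, dotProduct, Matrix.col]

theorem sum_encode {k κ n : ℕ} (hn : κ + k = n) (G' : Matrix (Fin k) (Fin n) (ZMod 2))
    (G : Matrix (Fin κ) (Fin n) (ZMod 2))
    (hG : LinearIndependent (ZMod 2) (Matrix.fromRows G' G).row) (f : BitVec2 n → ℝ) :
    ∑ m, ∑ m', f (encode G' G m m') = ∑ x, f x := by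
  have hinj := Matrix.vecMul_injective_iff.2 hG
  have hbij : Function.Bijective fun p : BitVec2 k × BitVec2 κ => encode G' G p.1 p.2 := by
    rw [Fintype.bijective_iff_injective_and_card]
    refine ⟨hinj.comp (Equiv.sumArrowEquivProdArrow (Fin k) (Fin κ) (ZMod 2)).symm.injective, ?_⟩
    simp [← hn, pow_add, mul_comm]
  rw [← Fintype.sum_prod_type' fun m m' => f (encode G' G m m')]
  exact hbij.sum_comp f

/-- The auxiliary messages compatible with a given message and a given received word form a coset
of the hidden space, or there are none. -/
theorem card_agrees_encode {k κ n : ℕ} (G' : Matrix (Fin k) (Fin n) (ZMod 2))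
    (G : Matrix (Fin κ) (Fin n) (ZMod 2)) (m : BitVec2 k) (z : Received n)
    (h : ∃ m', Agrees (encode G' G m m') z) :
    (Finset.univ.filter fun m' => Agrees (encode G' G m m') z).card =
      2 ^ finrank (ZMod 2) (hiddenSpace G (revealed z)) := by
  classical
  obtain ⟨m₀, h₀⟩ := h
  have hcard := Module.card_eq_pow_finrank (K := ZMod 2) (V := hiddenSpace G (revealed z))
  rw [ZMod.card] at hcard
  rw [← hcard, ← Finset.card_univ]
  symm
  refine Finset.card_bij (fun v _ => m₀ + v.1) (fun v _ => ?_) (fun v _ w _ hvw => ?_)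
    (fun m' hm' => ?_)
  · rw [Finset.mem_filter]
    refine ⟨Finset.mem_univ _, fun i hi => ?_⟩
    rw [h₀ i hi, encode_apply, encode_apply, add_dotProduct, v.2 i hi, add_zero]
  · exact Subtype.ext (add_left_cancel hvw)
  · refine ⟨⟨m' - m₀, fun i hi => ?_⟩, Finset.mem_univ _, add_sub_cancel _ _⟩
    have := (Finset.mem_filter.1 hm').2 i hi
    rw [h₀ i hi, Option.some_inj, encode_apply, encode_apply, add_right_inj] at this
    rw [sub_dotProduct, this, sub_self]

theorem card_agrees {n : ℕ} (z : Received n) :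
    (Finset.univ.filter fun x => Agrees x z).card = 2 ^ (n - (revealed z).card) := by
  classical
  have : (Finset.univ.filter fun x => Agrees x z) =
      Fintype.piFinset fun i => if z i = none then Finset.univ else {(z i).getD 0} := by
    ext x
    simp only [Finset.mem_filter, Finset.mem_univ, true_and, Fintype.mem_piFinset, Agrees, revealed]
    refine forall_congr' fun i => ?_
    rcases hz : z i with _ | a <;> simp [eq_comm]
  rw [this, Fintype.card_piFinset]
  have hcompl : (Finset.univ.filter fun i => z i = none).card = n - (revealed z).card := by
    have := Finset.card_filter_add_card_filter_not (s := (Finset.univ : Finset (Fin n)))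
      (fun i => z i = none)
    rw [Finset.card_univ, Fintype.card_fin] at this
    simp only [revealed, ne_eq]
    omega
  rw [← hcompl, ← Finset.prod_const, Finset.prod_filter]
  refine Finset.prod_congr rfl fun i _ => ?_
  split_ifs <;> simp

/-- For a fixed codeword `x`, the received words that agree with `x` correspond to the sets of
revealed positions. -/
theorem sum_agrees {n : ℕ} (x : BitVec2 n) (g : Finset (Fin n) → ℝ) :
    (∑ z, if Agrees x z then g (revealed z) else 0) = ∑ R, g R := by
  classical
  rw [← Finset.sum_filter]
  refine Finset.sum_bij' (fun z _ => revealed z)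
    (fun R _ i => if i ∈ R then some (x i) else none) (by simp) (fun R _ => ?_) (fun z hz => ?_)
    (fun R _ => ?_) (fun _ _ => rfl)
  · simp [Agrees, revealed]
  · funext i
    have h := (Finset.mem_filter.1 hz).2 i
    by_cases hi : i ∈ revealed z
    · simp [hi, h hi]
    · have hz' : z i = none := by simpa [revealed] using hi
      simp [hi, hz']
  · ext i
    simp [revealed]

/-- The equivocation loss of the code over a channel that reveals the positions in `R` with
probability `w R`, independently of the codeword. Here `#R - κ + dim (hiddenSpace G R)` is
`#R - rank G_R`, the number of bits of information on the message contained in the positions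
in `R`. -/
theorem equivocationLoss_eq_sum {k κ n : ℕ} (hn : κ + k = n)
    (G' : Matrix (Fin k) (Fin n) (ZMod 2)) (G : Matrix (Fin κ) (Fin n) (ZMod 2))
    (hG : LinearIndependent (ZMod 2) (Matrix.fromRows G' G).row)
    (channel : BitVec2 n → Received n → ℝ) (w : Finset (Fin n) → ℝ)
    (hchannel : ∀ x z, channel x z = if Agrees x z then w (revealed z) else 0)
    (hw : ∑ R, w R = 1) :
    equivocationLoss channel G' G =
      ∑ R, w R * ((R.card : ℝ) - κ + finrank (ZMod 2) (hiddenSpace G R)) := by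
  classical
  set p := jointDist channel G' G with hp
  have hpg : ∀ m (g : Finset (Fin n) → ℝ),
      ∑ z, p m z * g (revealed z) = 1 / 2 ^ k * ∑ R, w R * g R := by
    intro m g
    simp only [hp, jointDist, Finset.sum_mul]
    rw [Finset.sum_comm]
    simp only [mul_assoc, ← Finset.mul_sum, hchannel, ite_mul, zero_mul]
    simp only [sum_agrees _ fun R => w R * g R]
    simp
  have hpm : ∀ m, ∑ z, p m z = 1 / 2 ^ k := by
    intro m
    simpa [hw] using hpg m fun _ => 1
  have hpz : ∀ z, ∑ m, p m z = w (revealed z) / 2 ^ (revealed z).card := by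
    intro z
    simp only [hp, jointDist]
    rw [sum_encode hn G' G hG fun x => (1 / 2 ^ k : ℝ) * (1 / 2 ^ κ : ℝ) * channel x z,
      ← Finset.mul_sum]
    simp only [hchannel]
    rw [← Finset.sum_filter, Finset.sum_const, card_agrees, nsmul_eq_mul]
    have hR : (revealed z).card ≤ n := by simpa using Finset.card_le_univ (revealed z)
    have h2 : (2 : ℝ) ^ k * 2 ^ κ = 2 ^ (n - (revealed z).card) * 2 ^ (revealed z).card := by
      rw [← pow_add, ← pow_add]
      congr 1
      omega
    push_cast
    field_simp
    rw [mul_right_comm, mul_comm (_ ^ _) (_ ^ κ), mul_comm (_ ^ κ), h2]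
  have hterm : ∀ m z, p m z * Real.logb 2 (p m z / ((∑ b', p m b') * (∑ a', p a' z))) =
      p m z * ((revealed z).card - κ + finrank (ZMod 2) (hiddenSpace G (revealed z)) : ℝ) := by
    intro m z
    rw [hpm, hpz]
    rcases eq_or_ne (p m z) 0 with h0 | h0
    · rw [h0, zero_mul, zero_mul]
    congr 1
    have hpmz : p m z = (1 / 2 ^ k : ℝ) * (1 / 2 ^ κ : ℝ) *
        ((Finset.univ.filter fun m' => Agrees (encode G' G m m') z).card * w (revealed z)) := by
      simp only [hp, jointDist]
      rw [← Finset.mul_sum]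
      simp only [hchannel]
      rw [← Finset.sum_filter, Finset.sum_const, nsmul_eq_mul]
    have hne : w (revealed z) ≠ 0 := by
      rintro h
      exact h0 (by rw [hpmz, h, mul_zero, mul_zero])
    have hex : ∃ m', Agrees (encode G' G m m') z := by
      by_contra hno
      push Not at hno
      apply h0
      rw [hpmz, Finset.filter_false_of_mem fun m' _ => ?_]
      · simp
      · simpa [Agrees] using hno m'
    rw [hpmz, card_agrees_encode G' G m z hex]
    push_cast
    generalize finrank (ZMod 2) (hiddenSpace G (revealed z)) = d
    have : (1 / 2 ^ k * (1 / 2 ^ κ) * (2 ^ d * w (revealed z)) /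
        (1 / 2 ^ k * (w (revealed z) / 2 ^ (revealed z).card)) : ℝ) =
        2 ^ (((revealed z).card : ℝ) - κ + d) := by
      rw [Real.rpow_add two_pos, Real.rpow_sub two_pos]
      simp only [Real.rpow_natCast]
      field_simp
    rw [this, Real.logb_rpow two_pos (by norm_num)]
  unfold equivocationLoss mutualInformation
  simp only [← hp, hterm]
  simp only [hpg _ fun R => (R.card - κ + finrank (ZMod 2) (hiddenSpace G R) : ℝ)]
  simp

/-! ### Probability that all revealed columns lie in a given subspace -/

open Classical in
/-- The positions whose column of `G` lies in `S`. -/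
noncomputable def columnsIn {κ n : ℕ} (G : Matrix (Fin κ) (Fin n) (ZMod 2))
    (S : Submodule (ZMod 2) (BitVec2 κ)) : Finset (Fin n) :=
  Finset.univ.filter fun j => G.col j ∈ S

theorem subset_columnsIn {κ n : ℕ} {G : Matrix (Fin κ) (Fin n) (ZMod 2)}
    {S : Submodule (ZMod 2) (BitVec2 κ)} {R : Finset (Fin n)} :
    R ⊆ columnsIn G S ↔ ∀ j ∈ R, G.col j ∈ S := by
  simp [columnsIn, Finset.subset_iff]

theorem binaryExpansion_bijective (κ : ℕ) :
    Function.Bijective (binaryExpansion : Fin (2 ^ κ) → BitVec2 κ) := by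
  rw [Fintype.bijective_iff_injective_and_card]
  refine ⟨fun a b h => Fin.ext (Nat.eq_of_testBit_eq fun j => ?_), by simp⟩
  rcases lt_or_ge j κ with hj | hj
  · have hj' := congrFun h ⟨j, hj⟩
    simp only [binaryExpansion] at hj'
    cases ha : a.1.testBit j <;> cases hb : b.1.testBit j <;> simp_all
  · rw [Nat.testBit_lt_two_pow (a.2.trans_le (Nat.pow_le_pow_right two_pos hj)),
      Nat.testBit_lt_two_pow (b.2.trans_le (Nat.pow_le_pow_right two_pos hj))]

/-- `ζ(S)` is the fraction of the columns of `G` lying in `S`, as each column is `ν(i)` for exactly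
one `i`. -/
theorem zeta_columnFraction {κ n : ℕ} (G : Matrix (Fin κ) (Fin n) (ZMod 2))
    (S : Submodule (ZMod 2) (BitVec2 κ)) :
    zeta (columnFraction G) S = (columnsIn G S).card / n := by
  classical
  simp only [zeta, columnFraction]
  rw [← Finset.sum_div, ← Nat.cast_sum]
  congr 2
  rw [Finset.card_eq_sum_card_fiberwise (f := G.col)
    (t := Finset.univ.filter fun v => v ∈ S) (fun j hj => by simpa [columnsIn] using hj)]
  refine Finset.sum_bij (fun i _ => binaryExpansion i) (fun i hi => by simpa using hi)
    (fun a _ b _ h => (binaryExpansion_bijective κ).1 h) (fun v hv => ?_) (fun i hi => ?_)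
  · obtain ⟨i, rfl⟩ := (binaryExpansion_bijective κ).2 v
    exact ⟨i, by simpa using hv, rfl⟩
  · congr 1
    ext j
    simp only [columnsIn, Finset.mem_filter, Finset.mem_univ, true_and] at hi ⊢
    exact ⟨fun h => ⟨h ▸ hi, h⟩, And.right⟩

theorem natCast_mul_zeta {κ n : ℕ} (G : Matrix (Fin κ) (Fin n) (ZMod 2))
    (S : Submodule (ZMod 2) (BitVec2 κ)) :
    (n : ℝ) * zeta (columnFraction G) S = (columnsIn G S).card := by
  rw [zeta_columnFraction]
  rcases n.eq_zero_or_pos with rfl | hn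
  · simp [Finset.eq_empty_of_isEmpty]
  · field_simp

/-- The equivocation loss in terms of the probabilities that all revealed columns lie in `S`. -/
theorem equivocationLoss_eq {k κ n : ℕ} (hn : κ + k = n)
    (G' : Matrix (Fin k) (Fin n) (ZMod 2)) (G : Matrix (Fin κ) (Fin n) (ZMod 2))
    (hG : LinearIndependent (ZMod 2) (Matrix.fromRows G' G).row)
    (channel : BitVec2 n → Received n → ℝ) (w : Finset (Fin n) → ℝ)
    (hchannel : ∀ x z, channel x z = if Agrees x z then w (revealed z) else 0)
    (hw : ∑ R, w R = 1) :
    equivocationLoss channel G' G = ∑ R, w R * R.card - κ + ∑ δ ∈ Finset.Icc 1 κ, K δ *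
      ∑ S ∈ subspacesOfDim (⊤ : Submodule (ZMod 2) (BitVec2 κ)) (κ - δ),
        ∑ R ∈ (columnsIn G S).powerset, w R := by
  classical
  rw [equivocationLoss_eq_sum hn G' G hG channel w hchannel hw]
  simp only [mul_add, mul_sub, Finset.sum_add_distrib, Finset.sum_sub_distrib, ← Finset.sum_mul,
    hw, one_mul]
  congr 1
  simp only [finrank_hiddenSpace, Finset.mul_sum]
  rw [Finset.sum_comm]
  refine Finset.sum_congr rfl fun δ _ => ?_
  rw [Finset.sum_comm]
  refine Finset.sum_congr rfl fun S _ => ?_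
  rw [← Finset.filter_subset_univ, Finset.sum_filter]
  refine Finset.sum_congr rfl fun R _ => ?_
  simp only [subset_columnsIn]
  split_ifs <;> ring

/-! ### A uniformly distributed set of `μ` revealed positions -/

/-- The uniform distribution on the `μ`-element sets of positions. -/
noncomputable def uniformWeight (n μ : ℕ) (R : Finset (Fin n)) : ℝ :=
  if R.card = μ then 1 / (n.choose μ : ℝ) else 0

theorem sum_uniformWeight_powerset {n : ℕ} (μ : ℕ) (J : Finset (Fin n)) :
    ∑ R ∈ J.powerset, uniformWeight n μ R = (J.card.choose μ : ℝ) / n.choose μ := by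
  simp only [uniformWeight]
  rw [← Finset.sum_filter, ← Finset.powersetCard_eq_filter, Finset.sum_const,
    Finset.card_powersetCard, nsmul_eq_mul, mul_one_div]

theorem choose_div_choose_eq_prod (a : ℕ) {n μ : ℕ} (hμ : μ ≤ n) :
    (a.choose μ : ℝ) / n.choose μ =
      ∏ i ∈ Finset.range μ, ((a : ℝ) / n - i / n) / (1 - i / n) := by
  have hdesc : ∀ b : ℕ, ∏ i ∈ Finset.range μ, ((b : ℝ) - i) = μ.factorial * b.choose μ := by
    intro b
    rw [← Nat.cast_mul, ← Nat.descFactorial_eq_factorial_mul_choose,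
      ← descPochhammer_eval_eq_descFactorial, descPochhammer_eval_eq_prod_range]
  have hfac : (μ.factorial : ℝ) ≠ 0 := Nat.cast_ne_zero.2 μ.factorial_ne_zero
  rw [← mul_div_mul_left _ _ hfac, ← hdesc, ← hdesc, ← Finset.prod_div_distrib]
  refine Finset.prod_congr rfl fun i hi => ?_
  have hn : (n : ℝ) ≠ 0 := by
    have := Finset.mem_range.1 hi
    exact Nat.cast_ne_zero.2 (by omega)
  rw [← sub_div, one_sub_div hn, div_div_div_cancel_right₀ hn]

theorem equivocationLoss_fixedRevealChannel {k κ n : ℕ} (hn : κ + k = n)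
    (G' : Matrix (Fin k) (Fin n) (ZMod 2)) (G : Matrix (Fin κ) (Fin n) (ZMod 2))
    (hG : LinearIndependent (ZMod 2) (Matrix.fromRows G' G).row) {μ : ℕ} (hμ : μ ≤ n) :
    equivocationLoss (fixedRevealChannel μ) G' G =
      (μ : ℝ) - κ + ∑ δ ∈ Finset.Icc 1 κ, K δ *
        ∑ S ∈ subspacesOfDim (⊤ : Submodule (ZMod 2) (BitVec2 κ)) (κ - δ),
          PhiFixed n μ (columnFraction G) S := by
  have hw : ∑ R, uniformWeight n μ R = 1 := by
    rw [← Finset.powerset_univ, sum_uniformWeight_powerset, Finset.card_univ, Fintype.card_fin,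
      div_self (Nat.cast_ne_zero.2 (Nat.choose_pos hμ).ne')]
  rw [equivocationLoss_eq hn G' G hG _ (uniformWeight n μ) (fun x z => ?_) hw]
  · congr 1
    · congr 1
      rw [← one_mul (μ : ℝ), ← hw, Finset.sum_mul]
      refine Finset.sum_congr rfl fun R _ => ?_
      unfold uniformWeight
      split_ifs with h
      · rw [h]
      · simp
    · simp only [sum_uniformWeight_powerset, choose_div_choose_eq_prod _ hμ, PhiFixed,
        zeta_columnFraction]
  · simp only [fixedRevealChannel, uniformWeight, Agrees]
    split_ifs <;> simp_all

/-! ### Independent erasures -/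

/-- The distribution of the set of revealed positions when every position is erased independently
with probability `ε`. -/
noncomputable def binomialWeight (n : ℕ) (ε : ℝ) (R : Finset (Fin n)) : ℝ :=
  (1 - ε) ^ R.card * ε ^ (n - R.card)

/-- The revealed positions lie in `J` exactly when the positions outside `J` are erased. -/
theorem sum_binomialWeight_powerset {n : ℕ} (ε : ℝ) (J : Finset (Fin n)) :
    ∑ R ∈ J.powerset, binomialWeight n ε R = ε ^ (n - J.card) := by
  have hJ : J.card ≤ n := by simpa using Finset.card_le_univ J
  have h := Finset.sum_pow_mul_eq_add_pow (1 - ε) ε J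
  rw [sub_add_cancel, one_pow] at h
  rw [← mul_one (ε ^ _), ← h, Finset.mul_sum]
  refine Finset.sum_congr rfl fun R hR => ?_
  have hRJ := Finset.card_le_card (Finset.mem_powerset.1 hR)
  rw [binomialWeight, show n - R.card = (n - J.card) + (J.card - R.card) by omega, pow_add]
  ring

theorem sum_binomialWeight {n : ℕ} (ε : ℝ) : ∑ R, binomialWeight n ε R = 1 := by
  rw [← Finset.powerset_univ, sum_binomialWeight_powerset, Finset.card_univ, Fintype.card_fin,
    Nat.sub_self, pow_zero]

theorem sum_binomialWeight_mul_card (n : ℕ) (ε : ℝ) :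
    ∑ R, binomialWeight n ε R * R.card = n * (1 - ε) := by
  -- The position `j` is unrevealed when the revealed set lies in the complement of `{j}`.
  have hcard : ∀ R : Finset (Fin n),
      (R.card : ℝ) = ∑ j, (1 - if R ⊆ {j}ᶜ then 1 else 0) := by
    intro R
    have : ∀ j, (1 - if R ⊆ {j}ᶜ then 1 else 0 : ℝ) = if j ∈ R then 1 else 0 := by
      intro j
      by_cases hj : j ∈ R <;> simp [hj]
    rw [Finset.sum_congr rfl fun j _ => this j]
    simp
  simp only [hcard, Finset.mul_sum, mul_sub, mul_one]
  rw [Finset.sum_comm]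
  have hj : ∀ j : Fin n, ∑ R, (binomialWeight n ε R -
      binomialWeight n ε R * if R ⊆ {j}ᶜ then 1 else 0) = 1 - ε := by
    intro j
    have hn : n - (({j}ᶜ : Finset (Fin n)).card) = 1 := by
      have := j.2
      rw [Finset.card_compl, Finset.card_singleton, Fintype.card_fin]
      omega
    rw [Finset.sum_sub_distrib, sum_binomialWeight]
    simp only [mul_ite, mul_one, mul_zero]
    rw [← Finset.sum_filter, Finset.filter_subset_univ, sum_binomialWeight_powerset, hn, pow_one]
  rw [Finset.sum_congr rfl fun j _ => hj j]
  simp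

theorem erasureChannel_eq {n : ℕ} (ε : ℝ) (x : BitVec2 n) (z : Received n) :
    erasureChannel ε x z = if Agrees x z then binomialWeight n ε (revealed z) else 0 := by
  classical
  unfold erasureChannel
  split_ifs with h
  · have : ∀ i, (if z i = none then ε else if z i = some (x i) then 1 - ε else 0) =
        if i ∈ revealed z then 1 - ε else ε := by
      intro i
      by_cases hi : i ∈ revealed z
      · simp [hi, h i hi]
      · have hz : z i = none := by simpa [revealed] using hi
        simp [hi, hz]
    simp only [this]
    rw [Finset.prod_ite]
    simp [binomialWeight, Finset.filter_not, Finset.card_sdiff]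
  · simp only [Agrees, not_forall] at h
    obtain ⟨i, hi, hne⟩ := h
    have hz : z i ≠ none := by simpa [revealed] using hi
    exact Finset.prod_eq_zero (Finset.mem_univ i) (by simp [hz, hne])

theorem equivocationLoss_erasureChannel {k κ n : ℕ} (hn : κ + k = n)
    (G' : Matrix (Fin k) (Fin n) (ZMod 2)) (G : Matrix (Fin κ) (Fin n) (ZMod 2))
    (hG : LinearIndependent (ZMod 2) (Matrix.fromRows G' G).row) (ε : ℝ) :
    equivocationLoss (erasureChannel ε) G' G =
      (n : ℝ) * (1 - ε) - κ + ∑ δ ∈ Finset.Icc 1 κ, K δ *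
        ∑ S ∈ subspacesOfDim (⊤ : Submodule (ZMod 2) (BitVec2 κ)) (κ - δ),
          phiErasure n ε (columnFraction G) S := by
  rw [equivocationLoss_eq hn G' G hG _ (binomialWeight n ε) (erasureChannel_eq ε)
    (sum_binomialWeight ε), sum_binomialWeight_mul_card]
  congr 1
  refine Finset.sum_congr rfl fun δ _ => ?_
  congr 1
  refine Finset.sum_congr rfl fun S _ => ?_
  have hJ : (columnsIn G S).card ≤ n := by simpa using Finset.card_le_univ (columnsIn G S)
  rw [sum_binomialWeight_powerset, phiErasure, mul_sub, mul_one, natCast_mul_zeta,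
    ← Nat.cast_sub hJ, Real.rpow_natCast]

end CosetCode

theorem theorem1 (n k κ : ℕ) (hn : κ + k = n)
    (G' : Matrix (Fin k) (Fin n) (ZMod 2)) (G : Matrix (Fin κ) (Fin n) (ZMod 2))
    (hG : LinearIndependent (ZMod 2) (Matrix.fromRows G' G).row)
    (q : Fin (2 ^ κ) → ℝ) (hq : ∀ i, q i = CosetCode.columnFraction G i) :
    (∀ μ : ℕ, 0 < μ → μ ≤ n →
      CosetCode.equivocationLoss (CosetCode.fixedRevealChannel μ) G' G =
        (μ : ℝ) - (κ : ℝ) + ∑ δ ∈ Finset.Icc 1 κ, CosetCode.K δ *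
          ∑ S ∈ CosetCode.subspacesOfDim (⊤ : Submodule (ZMod 2) (Fin κ → ZMod 2)) (κ - δ),
            CosetCode.PhiFixed n μ q S) ∧
    (∀ ε : ℝ, 0 ≤ ε → ε ≤ 1 →
      CosetCode.equivocationLoss (CosetCode.erasureChannel ε) G' G =
        (n : ℝ) * (1 - ε) - (κ : ℝ) + ∑ δ ∈ Finset.Icc 1 κ, CosetCode.K δ *
          ∑ S ∈ CosetCode.subspacesOfDim (⊤ : Submodule (ZMod 2) (Fin κ → ZMod 2)) (κ - δ),
            CosetCode.phiErasure n ε q S) := by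
  obtain rfl : q = CosetCode.columnFraction G := funext hq
  exact ⟨fun _ _ hμ => CosetCode.equivocationLoss_fixedRevealChannel hn G' G hG hμ,
    fun ε _ _ => CosetCode.equivocationLoss_erasureChannel hn G' G hG ε⟩
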